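/- Let $p,n_0\in\mathbb N=\{1,2,\dots\}$ with $n_0>p$, let $\ell\in\mathbb N_0$, and put $n_\ell=n_02^\ell$, $h_\ell=1/n_\ell$, $\Omega=(0,1)$. Let $S_{p,\ell}(0,1)$ be the space of all functions in $C^{p-1}(0,1)$ that are polynomials of degree at most $p$ on each subinterval $((i-1)h_\ell,ih_\ell)$, $i=1,\dots,n_\ell$, and let $\widetilde S_{p,\ell}(0,1)$ be the subspace of all $u\in S_{p,\ell}(0,1)$ whose odd derivatives of order less than $p$ vanish at the boundary, i.e. $u^{(2l+1)}(0)=u^{(2l+1)}(1)=0$ for all $l\in\mathbb N_0$ with $2l+1<p$ (the boundary values being one-sided limits from inside $(0,1)$). Let $(u,v)_A=\int_0^1u'v'\,dx+\int_0^1uv\,dx$ and $\|u\|_A=(u,u)_A^{1/2}=\|u\|_{H^1(0,1)}$, and let $\widetilde T_\ell:S_{p,\ell}(0,1)\to\widetilde S_{p,\ell}(0,1)$ be the $A$-orthogonal projector. Fix a basis of $S_{p,\ell}(0,1)$ (for example the B-spline basis); let $M_\ell$ be the mass matrix (pairwise $L^2(0,1)$ scalar products of the basis functions), $A$ the stiffness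 matrix (pairwise $(\cdot,\cdot)_A$ products of the basis functions), and write $\widetilde T_\ell$ also for the matrix of the projector in this basis. Set $$\widetilde L_\ell=h_\ell^{-2}M_\ell+(I-\widetilde T_\ell)^TA(I-\widetilde T_\ell),\qquad \|u_\ell\|_{\widetilde L_\ell}=(\widetilde L_\ell\underline u_\ell,\underline u_\ell)^{1/2},$$ where $\underline u_\ell$ is the coefficient vector of $u_\ell$ and $(\cdot,\cdot)$ is the Euclidean scalar product. Then there is a constant $c>0$, independent of $\ell$, $p$, $n_0$ and of the choice of the basis, such that $$\|u_\ell\|_A\le c\,\|u_\ell\|_{\widetilde L_\ell}\qquad\text{for all }u_\ell\in S_{p,\ell}(0,1).$$ -/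

import Mathlib

open Set Filter Topology MeasureTheory

noncomputable section

namespace IgA

/-- The knots `i / n` of the uniform grid with `n` subintervals. -/
def knots (n : ℕ) : Set ℝ := Set.range fun i : ℕ => (i : ℝ) / n

/-- `u` is a spline of degree `p` and maximal smoothness on `Ω = (0,1)` with respect to the uniform
grid with `n` subintervals: `u` is of class `C^(p-1)` on `Ω` and is a polynomial of degree at
most `p` on each subinterval.  Functions `Ω → ℝ` are represented by their extension by zero to
`ℝ`, so that two splines are equal exactly when they agree on `Ω`. -/
structure IsSpline (p n : ℕ) (u : ℝ → ℝ) : Prop where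
  contDiffOn : ContDiffOn ℝ ((p - 1 : ℕ) : WithTop ℕ∞) u (Ioo 0 1)
  piecewise : ∀ i : Fin n, ∃ q : Polynomial ℝ, q.natDegree ≤ p ∧
    EqOn u (fun x => q.eval x) (Ioo ((i : ℝ) / n) (((i : ℝ) + 1) / n))
  zero_off : ∀ x, x ∉ Ioo (0 : ℝ) 1 → u x = 0

/-- The spline space `S_p(0,1)` on the uniform grid with `n` subintervals. -/
def splineSpace (p n : ℕ) : Submodule ℝ (ℝ → ℝ) where
  carrier := {u | IsSpline p n u}
  zero_mem' := ⟨contDiffOn_const, fun _ => ⟨0, by simp, fun x _ => by simp⟩, fun _ _ => rfl⟩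
  add_mem' := by
    intro u v hu hv
    refine ⟨hu.contDiffOn.add hv.contDiffOn, fun i => ?_, fun x hx => ?_⟩
    · obtain ⟨q, hq, hqu⟩ := hu.piecewise i
      obtain ⟨r, hr, hrv⟩ := hv.piecewise i
      refine ⟨q + r, (Polynomial.natDegree_add_le _ _).trans (max_le hq hr), fun x hx => ?_⟩
      simp [hqu hx, hrv hx]
    · simp [hu.zero_off x hx, hv.zero_off x hx]
  smul_mem' := by
    intro a u hu
    refine ⟨hu.contDiffOn.const_smul a, fun i => ?_, fun x hx => ?_⟩
    · obtain ⟨q, hq, hqu⟩ := hu.piecewise i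
      refine ⟨a • q, (Polynomial.natDegree_smul_le _ _).trans hq, fun x hx => ?_⟩
      simp [hqu hx]
    · simp [hu.zero_off x hx]

theorem contDiffAt_of_mem {p n : ℕ} {u : ℝ → ℝ} (hu : IsSpline p n u) {x : ℝ}
    (hx : x ∈ Ioo (0 : ℝ) 1) {k : ℕ} (hk : k < p) : ContDiffAt ℝ k u x :=
  (hu.contDiffOn.contDiffAt (isOpen_Ioo.mem_nhds hx)).of_le (by exact_mod_cast by omega)

/-- The subspace of all splines whose odd derivatives of order less than `p` vanish at the
boundary points `0` and `1`.  The boundary value of a derivative is its one-sided limit from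
inside `(0,1)`. -/
def splineSpaceTilde (p n : ℕ) : Submodule ℝ (splineSpace p n) where
  carrier := {u | ∀ l : ℕ, 2 * l + 1 < p →
    Tendsto (iteratedDeriv (2 * l + 1) (u : ℝ → ℝ)) (𝓝[>] 0) (𝓝 0) ∧
    Tendsto (iteratedDeriv (2 * l + 1) (u : ℝ → ℝ)) (𝓝[<] 1) (𝓝 0)}
  zero_mem' := by
    intro l _
    have h : iteratedDeriv (2 * l + 1) ((0 : splineSpace p n) : ℝ → ℝ) = fun _ => 0 := by
      ext x
      simp [Pi.zero_def]
    rw [h]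
    exact ⟨tendsto_const_nhds, tendsto_const_nhds⟩
  add_mem' := by
    intro u v hu hv l hl
    have key : ∀ x ∈ Ioo (0 : ℝ) 1,
        iteratedDeriv (2 * l + 1) (u : ℝ → ℝ) x + iteratedDeriv (2 * l + 1) (v : ℝ → ℝ) x =
          iteratedDeriv (2 * l + 1) ((u + v : splineSpace p n) : ℝ → ℝ) x := fun x hx =>
      (iteratedDeriv_add (contDiffAt_of_mem u.2 hx hl) (contDiffAt_of_mem v.2 hx hl)).symm
    constructor
    · have h := (hu l hl).1.add (hv l hl).1
      rw [add_zero] at h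
      refine h.congr' ?_
      filter_upwards [Ioo_mem_nhdsGT (zero_lt_one' ℝ)] with x hx using key x hx
    · have h := (hu l hl).2.add (hv l hl).2
      rw [add_zero] at h
      refine h.congr' ?_
      filter_upwards [Ioo_mem_nhdsLT (zero_lt_one' ℝ)] with x hx using key x hx
  smul_mem' := by
    intro a u hu l hl
    have key : ∀ x ∈ Ioo (0 : ℝ) 1,
        a * iteratedDeriv (2 * l + 1) (u : ℝ → ℝ) x =
          iteratedDeriv (2 * l + 1) ((a • u : splineSpace p n) : ℝ → ℝ) x := fun x hx =>
      (iteratedDeriv_const_smul (contDiffAt_of_mem u.2 hx hl) a).symm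
    constructor
    · have h := (hu l hl).1.const_mul a
      rw [mul_zero] at h
      refine h.congr' ?_
      filter_upwards [Ioo_mem_nhdsGT (zero_lt_one' ℝ)] with x hx using key x hx
    · have h := (hu l hl).2.const_mul a
      rw [mul_zero] at h
      refine h.congr' ?_
      filter_upwards [Ioo_mem_nhdsLT (zero_lt_one' ℝ)] with x hx using key x hx

theorem exists_piece {n : ℕ} [NeZero n] {x : ℝ} (hx : x ∈ Ioo (0 : ℝ) 1) (hk : x ∉ knots n) :
    ∃ i : Fin n, x ∈ Ioo ((i : ℝ) / n) (((i : ℝ) + 1) / n) := by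
  have hn : (0 : ℝ) < n := by exact_mod_cast Nat.pos_of_ne_zero (NeZero.ne n)
  have h0 : 0 ≤ x * n := mul_nonneg hx.1.le hn.le
  have h1 : ⌊x * n⌋₊ < n := by
    rw [Nat.floor_lt h0]
    nlinarith [hx.2]
  refine ⟨⟨⌊x * n⌋₊, h1⟩, ?_, ?_⟩
  · refine lt_of_le_of_ne ?_ fun h => hk ⟨⌊x * n⌋₊, h⟩
    rw [div_le_iff₀ hn]
    exact Nat.floor_le h0
  · rw [lt_div_iff₀ hn]
    exact Nat.lt_floor_add_one _

theorem ae_not_knot (n : ℕ) : ∀ᵐ x ∂(volume.restrict (Ioo (0 : ℝ) 1)),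
    x ∈ Ioo (0 : ℝ) 1 ∧ x ∉ knots n := by
  refine (ae_restrict_mem measurableSet_Ioo).and (ae_restrict_of_ae ?_)
  exact (Set.countable_range _).ae_notMem _

theorem exists_local {p n : ℕ} [NeZero n] {u : ℝ → ℝ} (hu : IsSpline p n u) :
    ∃ q : Fin n → Polynomial ℝ, ∀ x ∈ Ioo (0 : ℝ) 1, x ∉ knots n → ∃ i,
      u x = (q i).eval x ∧ HasDerivAt u ((q i).derivative.eval x) x := by
  choose q _ hq using hu.piecewise
  refine ⟨q, fun x hx hk => ?_⟩
  obtain ⟨i, hi⟩ := exists_piece hx hk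
  refine ⟨i, hq i hi, ((q i).hasDerivAt x).congr_of_eventuallyEq ?_⟩
  filter_upwards [isOpen_Ioo.mem_nhds hi] with y hy using hq i hy

theorem exists_poly_bound {n : ℕ} (q : Fin n → Polynomial ℝ) :
    ∃ C : ℝ, ∀ i, ∀ x ∈ Ioo (0 : ℝ) 1, |(q i).eval x| ≤ C := by
  have h : ∀ i, ∃ C : ℝ, ∀ x ∈ Icc (0 : ℝ) 1, ‖(q i).eval x‖ ≤ C := fun i =>
    isCompact_Icc.exists_bound_of_continuousOn (q i).continuous.continuousOn
  choose C hC using h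
  refine ⟨∑ i, |C i|, fun i x hx => ?_⟩
  calc |(q i).eval x| ≤ |C i| := (hC i x (Ioo_subset_Icc_self hx)).trans (le_abs_self _)
    _ ≤ ∑ i, |C i| := Finset.single_le_sum (f := fun i => |C i|)
        (fun _ _ => abs_nonneg _) (Finset.mem_univ i)

theorem memLp_spline {p n : ℕ} [NeZero n] {u : ℝ → ℝ} (hu : IsSpline p n u) :
    MemLp u 2 (volume.restrict (Ioo (0 : ℝ) 1)) := by
  obtain ⟨q, hq⟩ := exists_local hu
  obtain ⟨C, hC⟩ := exists_poly_bound q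
  refine MemLp.of_bound (hu.contDiffOn.continuousOn.aestronglyMeasurable measurableSet_Ioo) C ?_
  filter_upwards [ae_not_knot n] with x hx
  obtain ⟨i, hi, _⟩ := hq x hx.1 hx.2
  rw [hi]
  exact hC i x hx.1

theorem memLp_deriv {p n : ℕ} [NeZero n] {u : ℝ → ℝ} (hu : IsSpline p n u) :
    MemLp (deriv u) 2 (volume.restrict (Ioo (0 : ℝ) 1)) := by
  obtain ⟨q, hq⟩ := exists_local hu
  obtain ⟨C, hC⟩ := exists_poly_bound fun i => (q i).derivative
  refine MemLp.of_bound (measurable_deriv u).aestronglyMeasurable C ?_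
  filter_upwards [ae_not_knot n] with x hx
  obtain ⟨i, _, hi⟩ := hq x hx.1 hx.2
  rw [hi.deriv]
  exact hC i x hx.1

theorem ae_differentiableAt {p n : ℕ} [NeZero n] {u : ℝ → ℝ} (hu : IsSpline p n u) :
    ∀ᵐ x ∂(volume.restrict (Ioo (0 : ℝ) 1)), DifferentiableAt ℝ u x := by
  obtain ⟨q, hq⟩ := exists_local hu
  filter_upwards [ae_not_knot n] with x hx
  obtain ⟨i, _, hi⟩ := hq x hx.1 hx.2
  exact hi.differentiableAt

/-- The scalar product `(u, v) = ∫ u v` of `L²(0,1)` on the spline space. -/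
def massForm (p n : ℕ) [NeZero n] : LinearMap.BilinForm ℝ (splineSpace p n) :=
  LinearMap.mk₂ ℝ (fun u v => ∫ x in Ioo (0 : ℝ) 1, (u : ℝ → ℝ) x * (v : ℝ → ℝ) x)
    (fun u u' v => by
      refine Eq.trans ?_ (integral_add ((memLp_spline u.2).integrable_mul (memLp_spline v.2))
        ((memLp_spline u'.2).integrable_mul (memLp_spline v.2)))
      exact integral_congr_ae (.of_forall fun x => add_mul _ _ _))
    (fun a u v => by
      rw [smul_eq_mul, ← integral_const_mul]
      exact integral_congr_ae (.of_forall fun x => mul_assoc _ _ _))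
    (fun u v v' => by
      refine Eq.trans ?_ (integral_add ((memLp_spline u.2).integrable_mul (memLp_spline v.2))
        ((memLp_spline u.2).integrable_mul (memLp_spline v'.2)))
      exact integral_congr_ae (.of_forall fun x => mul_add _ _ _))
    (fun a u v => by
      rw [smul_eq_mul, ← integral_const_mul]
      exact integral_congr_ae (.of_forall fun x => mul_left_comm _ _ _))

/-- The form `(u', v') = ∫ u' v'` on the spline space.  A spline of degree `p ≥ 1` is continuous
and piecewise polynomial, so its weak derivative is its classical derivative, which exists
everywhere except possibly at the knots. -/
def gradForm (p n : ℕ) [NeZero n] : LinearMap.BilinForm ℝ (splineSpace p n) :=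
  LinearMap.mk₂ ℝ
    (fun u v => ∫ x in Ioo (0 : ℝ) 1, deriv (u : ℝ → ℝ) x * deriv (v : ℝ → ℝ) x)
    (fun u u' v => by
      refine Eq.trans ?_ (integral_add ((memLp_deriv u.2).integrable_mul (memLp_deriv v.2))
        ((memLp_deriv u'.2).integrable_mul (memLp_deriv v.2)))
      refine integral_congr_ae ?_
      filter_upwards [ae_differentiableAt u.2, ae_differentiableAt u'.2] with x h h'
      change deriv ((u : ℝ → ℝ) + (u' : ℝ → ℝ)) x * _ = _
      rw [deriv_add h h', add_mul])
    (fun a u v => by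
      rw [smul_eq_mul, ← integral_const_mul]
      refine integral_congr_ae ?_
      filter_upwards [ae_differentiableAt u.2] with x h
      change deriv (a • (u : ℝ → ℝ)) x * _ = _
      rw [deriv_const_smul a h, smul_eq_mul, mul_assoc])
    (fun u v v' => by
      refine Eq.trans ?_ (integral_add ((memLp_deriv u.2).integrable_mul (memLp_deriv v.2))
        ((memLp_deriv u.2).integrable_mul (memLp_deriv v'.2)))
      refine integral_congr_ae ?_
      filter_upwards [ae_differentiableAt v.2, ae_differentiableAt v'.2] with x h h'
      change _ * deriv ((v : ℝ → ℝ) + (v' : ℝ → ℝ)) x = _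
      rw [deriv_add h h', mul_add])
    (fun a u v => by
      rw [smul_eq_mul, ← integral_const_mul]
      refine integral_congr_ae ?_
      filter_upwards [ae_differentiableAt v.2] with x h
      change _ * deriv (a • (v : ℝ → ℝ)) x = _
      rw [deriv_const_smul a h, smul_eq_mul, mul_left_comm])

/-- The energy scalar product `(u, v)_A = (u', v') + (u, v)`, that is, the scalar product of
`H¹(0,1)`, on the spline space. -/
def energyForm (p n : ℕ) [NeZero n] : LinearMap.BilinForm ℝ (splineSpace p n) :=
  gradForm p n + massForm p n

/-- The energy norm `‖u‖_A = (u, u)_A^(1/2) = ‖u‖_{H¹(0,1)}`. -/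
def energyNorm (p n : ℕ) [NeZero n] (u : splineSpace p n) : ℝ :=
  Real.sqrt (energyForm p n u u)

theorem eq_zero_of_ae {p n : ℕ} {u : ℝ → ℝ} (hu : IsSpline p n u)
    (h : u =ᵐ[volume.restrict (Ioo (0 : ℝ) 1)] 0) : u = 0 := by
  have h' := Measure.eqOn_open_of_ae_eq h isOpen_Ioo hu.contDiffOn.continuousOn continuousOn_const
  ext x
  by_cases hx : x ∈ Ioo (0 : ℝ) 1
  · exact h' hx
  · exact hu.zero_off x hx

theorem energyForm_pos {p n : ℕ} [NeZero n] {u : splineSpace p n} (hu : u ≠ 0) :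
    0 < energyForm p n u u := by
  have h1 : 0 ≤ gradForm p n u u := integral_nonneg fun x => mul_self_nonneg _
  have h2 : 0 ≤ massForm p n u u := integral_nonneg fun x => mul_self_nonneg _
  have h3 : massForm p n u u ≠ 0 := by
    intro h
    have hint := (memLp_spline u.2).integrable_mul (memLp_spline u.2)
    have h0 := (integral_eq_zero_iff_of_nonneg (fun x => mul_self_nonneg _) hint).1 h
    refine hu (Subtype.ext (eq_zero_of_ae u.2 ?_))
    filter_upwards [h0] with x hx using mul_self_eq_zero.1 hx
  have h4 := lt_of_le_of_ne h2 (Ne.symm h3)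
  change 0 < gradForm p n u u + massForm p n u u
  linarith

theorem energyForm_isRefl (p n : ℕ) [NeZero n] : (energyForm p n).IsRefl := by
  have hs : ∀ u v, energyForm p n u v = energyForm p n v u := fun u v => by
    change (∫ x in Ioo (0 : ℝ) 1, deriv (u : ℝ → ℝ) x * deriv (v : ℝ → ℝ) x) +
        (∫ x in Ioo (0 : ℝ) 1, (u : ℝ → ℝ) x * (v : ℝ → ℝ) x) =
      (∫ x in Ioo (0 : ℝ) 1, deriv (v : ℝ → ℝ) x * deriv (u : ℝ → ℝ) x) +
        (∫ x in Ioo (0 : ℝ) 1, (v : ℝ → ℝ) x * (u : ℝ → ℝ) x)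
    simp only [mul_comm]
  exact fun u v h => (hs v u).trans h

instance finiteDimensional_splineSpace (p n : ℕ) [NeZero n] :
    FiniteDimensional ℝ (splineSpace p n) := by
  have hn : (0 : ℝ) < n := by exact_mod_cast Nat.pos_of_ne_zero (NeZero.ne n)
  have hp : (0 : ℝ) < (p : ℝ) + 2 := by positivity
  let pt : Fin n → Fin (p + 1) → ℝ := fun i j => ((i : ℝ) + ((j : ℝ) + 1) / (p + 2)) / n
  let ev : splineSpace p n →ₗ[ℝ] (Fin n → Fin (p + 1) → ℝ) :=
    { toFun := fun u i j => (u : ℝ → ℝ) (pt i j)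
      map_add' := fun _ _ => rfl
      map_smul' := fun _ _ => rfl }
  refine FiniteDimensional.of_injective ev ((injective_iff_map_eq_zero ev).2 fun u hu => ?_)
  refine Subtype.ext (eq_zero_of_ae u.2 ?_)
  filter_upwards [ae_not_knot n] with x hx
  obtain ⟨i, hi⟩ := exists_piece hx.1 hx.2
  obtain ⟨q, hq, hqu⟩ := u.2.piecewise i
  have hinj : Function.Injective (pt i) := by
    intro j k hjk
    have h1 : ((i : ℝ) + ((j : ℝ) + 1) / (p + 2)) / n =
      ((i : ℝ) + ((k : ℝ) + 1) / (p + 2)) / n := hjk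
    rw [div_left_inj' hn.ne', add_right_inj, div_left_inj' hp.ne', add_left_inj] at h1
    exact Fin.ext (by exact_mod_cast h1)
  have hmem : ∀ j, pt i j ∈ Ioo ((i : ℝ) / n) (((i : ℝ) + 1) / n) := by
    intro j
    have hj : (j : ℝ) + 1 ≤ p + 1 := by exact_mod_cast j.2
    constructor
    · refine div_lt_div_of_pos_right ?_ hn
      have : (0 : ℝ) < ((j : ℝ) + 1) / (p + 2) := by positivity
      linarith
    · refine div_lt_div_of_pos_right ?_ hn
      have : ((j : ℝ) + 1) / (p + 2) < 1 := by
        rw [div_lt_one hp]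
        linarith
      linarith
  have hq0 : q = 0 := by
    refine Polynomial.eq_zero_of_natDegree_lt_card_of_eval_eq_zero q hinj (fun j => ?_) ?_
    · have h2 : (u : ℝ → ℝ) (pt i j) = 0 := congrFun (congrFun hu i) j
      rw [← h2]
      exact (hqu (hmem j)).symm
    · simpa using Nat.lt_succ_of_le hq
  simpa [hq0] using hqu hi

theorem isCompl_orthogonal (p n : ℕ) [NeZero n] :
    IsCompl (splineSpaceTilde p n)
      (LinearMap.BilinForm.orthogonal (energyForm p n) (splineSpaceTilde p n)) := by
  refine LinearMap.BilinForm.isCompl_orthogonal_of_restrict_nondegenerate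
    (energyForm_isRefl p n) ?_
  constructor
  · intro u hu
    by_contra h
    exact (energyForm_pos (u := (u : splineSpace p n)) fun h' => h (Subtype.ext h')).ne' (hu u)
  · intro u hu
    by_contra h
    exact (energyForm_pos (u := (u : splineSpace p n)) fun h' => h (Subtype.ext h')).ne' (hu u)

/-- The `A`-orthogonal projector of the spline space onto the subspace `splineSpaceTilde`, as a
linear map of the spline space into itself. -/
def projTilde (p n : ℕ) [NeZero n] : splineSpace p n →ₗ[ℝ] splineSpace p n :=
  Submodule.projection _ _ (isCompl_orthogonal p n)

/-- The norm `‖x‖_Q = (Q x, x)^(1/2)` of a coefficient vector `x`. -/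
def matrixNorm {m : ℕ} (Q : Matrix (Fin m) (Fin m) ℝ) (x : Fin m → ℝ) : ℝ :=
  Real.sqrt (Q.mulVec x ⬝ᵥ x)

section Matrices

variable (p n : ℕ) [NeZero n] {m : ℕ} (b : Module.Basis (Fin m) ℝ (splineSpace p n))

/-- The mass matrix, of the `L²` scalar products of the basis functions. -/
def massMatrix : Matrix (Fin m) (Fin m) ℝ := Matrix.of fun i j => massForm p n (b i) (b j)

/-- The stiffness matrix, of the energy scalar products of the basis functions. -/
def stiffnessMatrix : Matrix (Fin m) (Fin m) ℝ := Matrix.of fun i j => energyForm p n (b i) (b j)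

/-- The matrix representation of the projector `projTilde`. -/
def projMatrix : Matrix (Fin m) (Fin m) ℝ := LinearMap.toMatrix b b (projTilde p n)

/-- The matrix `h⁻² M + (I - T)ᵀ A (I - T)`, where `h = 1 / n` is the grid size. -/
def smootherMatrix : Matrix (Fin m) (Fin m) ℝ :=
  ((1 / (n : ℝ)) ^ 2)⁻¹ • massMatrix p n b +
    (1 - projMatrix p n b).transpose * stiffnessMatrix p n b * (1 - projMatrix p n b)

end Matrices

end IgA

end

noncomputable section

namespace IgA

open Polynomial

/-! Let `v` be the projection of `u` and `|·|` the L² norm. By Pythagoras `‖u‖_A² = ‖v‖_A² + ‖u -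
v‖_A²`, and the last term is already part of the smoother norm. It remains to bound `‖v‖_A²` by a
multiple of `n² |u|²`, with a factor free of `p` (`energyForm_projTilde_le`).

Orthogonality gives `‖v‖_A² = (v', u') + (v, u)`. For `p ≥ 2` the boundary conditions include `v' =
0` at both ends, so `(v', u') = -(v'', u)` although `u` satisfies no boundary condition
(`gradForm_sq_le`). The inverse inequality `|v''| ≤ √12 n |v'|` and Cauchy-Schwarz then leave one
factor `‖v‖_A` to cancel.

The inverse inequality is independent of `p` because of the vanishing odd derivatives
(`brokenForm_iterate_derivative_succ_le`). For the derivative of order `p - 1`, which is piecewise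
affine, it is elementary. It passes from order `k + 1` to order `k` through `|D^(k+1) v|² =
-(D^(k+2) v, D^k v) ≤ |D^(k+2) v| |D^k v|`, where the boundary terms vanish since one of `k`, `k +
1` is odd. -/

/-! ### Broken scalar product and integration by parts -/

theorem intervalIntegrable_eval (f : ℝ[X]) (a b : ℝ) :
    IntervalIntegrable (fun x => f.eval x) volume a b :=
  f.continuous.intervalIntegrable a b

/-- The scalar product `∫ f g` over `(0,1)` of two families of polynomials, where the `i`-th
members live on the subinterval `(i / n, (i + 1) / n)`. -/
def brokenForm (n : ℕ) : LinearMap.BilinForm ℝ (ℕ → ℝ[X]) :=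
  LinearMap.mk₂ ℝ
    (fun f g => ∑ i ∈ Finset.range n,
      ∫ x in ((i : ℝ) / n)..(((i : ℝ) + 1) / n), (f i * g i).eval x)
    (fun f f' g => by
      rw [← Finset.sum_add_distrib]
      refine Finset.sum_congr rfl fun i _ => ?_
      rw [← intervalIntegral.integral_add (intervalIntegrable_eval _ _ _)
        (intervalIntegrable_eval _ _ _)]
      simp [add_mul])
    (fun a f g => by
      rw [smul_eq_mul, Finset.mul_sum]
      refine Finset.sum_congr rfl fun i _ => ?_
      rw [← intervalIntegral.integral_const_mul]
      simp)
    (fun f g g' => by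
      rw [← Finset.sum_add_distrib]
      refine Finset.sum_congr rfl fun i _ => ?_
      rw [← intervalIntegral.integral_add (intervalIntegrable_eval _ _ _)
        (intervalIntegrable_eval _ _ _)]
      simp [mul_add])
    (fun a f g => by
      rw [smul_eq_mul, Finset.mul_sum]
      refine Finset.sum_congr rfl fun i _ => ?_
      rw [← intervalIntegral.integral_const_mul]
      simp)

theorem brokenForm_apply (n : ℕ) (f g : ℕ → ℝ[X]) :
    brokenForm n f g = ∑ i ∈ Finset.range n,
      ∫ x in ((i : ℝ) / n)..(((i : ℝ) + 1) / n), (f i * g i).eval x := rfl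

theorem brokenForm_isSymm (n : ℕ) : LinearMap.IsSymm (brokenForm n) :=
  ⟨fun f g => by simp [brokenForm_apply, mul_comm]⟩

theorem brokenForm_self_nonneg (n : ℕ) (f : ℕ → ℝ[X]) : 0 ≤ brokenForm n f f := by
  rw [brokenForm_apply]
  refine Finset.sum_nonneg fun i _ => intervalIntegral.integral_nonneg ?_ fun x _ => ?_
  · gcongr
    linarith
  · simpa using mul_self_nonneg _

/-- Cauchy-Schwarz needs only semidefiniteness. The form is not definite, since it ignores the
members with index at least `n`. -/
theorem brokenForm_sq_le (n : ℕ) (f g : ℕ → ℝ[X]) :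
    brokenForm n f g ^ 2 ≤ brokenForm n f f * brokenForm n g g :=
  LinearMap.BilinForm.apply_sq_le_of_symm _ (brokenForm_self_nonneg n) (brokenForm_isSymm n) f g

/-- The members of the family `f` fit together continuously at the interior knots. -/
def Matching (n : ℕ) (f : ℕ → ℝ[X]) : Prop :=
  ∀ i : ℕ, i + 1 < n →
    (f i).eval (((i : ℝ) + 1) / n) = (f (i + 1)).eval (((i : ℝ) + 1) / n)

theorem Matching.mul {n : ℕ} {f g : ℕ → ℝ[X]} (hf : Matching n f) (hg : Matching n g) :
    Matching n (f * g) := fun i hi => by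
  simp [hf i hi, hg i hi]

/-- The sum telescopes: by matching, the contributions of each interior knot cancel. -/
theorem sum_integral_derivative {n : ℕ} (hn : n ≠ 0) {f : ℕ → ℝ[X]} (hf : Matching n f) :
    ∑ i ∈ Finset.range n,
      ∫ x in ((i : ℝ) / n)..(((i : ℝ) + 1) / n), (derivative (f i)).eval x =
    (f (n - 1)).eval 1 - (f 0).eval 0 := by
  have key : ∀ m : ℕ, m < n → ∑ i ∈ Finset.range (m + 1),
      ∫ x in ((i : ℝ) / n)..(((i : ℝ) + 1) / n), (derivative (f i)).eval x =
        (f m).eval (((m : ℝ) + 1) / n) - (f 0).eval 0 := by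
    have hint : ∀ i : ℕ, ∫ x in ((i : ℝ) / n)..(((i : ℝ) + 1) / n),
        (derivative (f i)).eval x =
          (f i).eval (((i : ℝ) + 1) / n) - (f i).eval ((i : ℝ) / n) := fun i =>
      intervalIntegral.integral_eq_sub_of_hasDerivAt (fun x _ => (f i).hasDerivAt x)
        (intervalIntegrable_eval _ _ _)
    intro m
    induction m with
    | zero => intro _; simp [hint]
    | succ m ih =>
      intro hm
      rw [Finset.sum_range_succ, ih (by omega), hint, hf m hm]
      push_cast
      ring
  have h := key (n - 1) (by omega)
  rw [Nat.sub_add_cancel (Nat.pos_of_ne_zero hn)] at h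
  rw [h, Nat.cast_sub (Nat.pos_of_ne_zero hn)]
  have : (n : ℝ) ≠ 0 := by exact_mod_cast hn
  simp [this]

/-- Integration by parts for continuous piecewise polynomials. -/
theorem brokenForm_derivative_left {n : ℕ} (hn : n ≠ 0) {f g : ℕ → ℝ[X]} (hf : Matching n f)
    (hg : Matching n g) (h0 : (f 0).eval 0 = 0 ∨ (g 0).eval 0 = 0)
    (h1 : (f (n - 1)).eval 1 = 0 ∨ (g (n - 1)).eval 1 = 0) :
    brokenForm n (fun i => derivative (f i)) g = -brokenForm n f (fun i => derivative (g i)) := by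
  have h := sum_integral_derivative hn (hf.mul hg)
  have e1 : ((f * g) (n - 1)).eval 1 = 0 := by simpa using h1
  have e0 : ((f * g) 0).eval 0 = 0 := by simpa using h0
  rw [e0, e1, sub_zero] at h
  rw [eq_neg_iff_add_eq_zero, ← h, brokenForm_apply, brokenForm_apply, ← Finset.sum_add_distrib]
  refine Finset.sum_congr rfl fun i _ => ?_
  rw [← intervalIntegral.integral_add (intervalIntegrable_eval _ _ _)
    (intervalIntegrable_eval _ _ _)]
  refine intervalIntegral.integral_congr fun x _ => ?_
  simp [derivative_mul]

/-! ### Inverse inequalities with constants independent of the degree -/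

/-- The inverse inequality for affine functions on an interval. -/
theorem integral_derivative_sq_le {a b : ℝ} (hab : a ≤ b) {f : ℝ[X]} (hf : f.natDegree ≤ 1) :
    (b - a) ^ 2 * ∫ x in a..b, (derivative f * derivative f).eval x ≤
      12 * ∫ x in a..b, (f * f).eval x := by
  obtain ⟨s, t, rfl⟩ := exists_eq_X_add_C_of_natDegree_le_one hf
  have h1 : ∫ x in a..b, ((derivative (C s * X + C t)) * (derivative (C s * X + C t))).eval x =
      s ^ 2 * (b - a) := by
    simp
    ring
  have h2 : ∫ x in a..b, ((C s * X + C t) * (C s * X + C t)).eval x =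
      (s ^ 2 / 3 * b ^ 3 + s * t * b ^ 2 + t ^ 2 * b) -
        (s ^ 2 / 3 * a ^ 3 + s * t * a ^ 2 + t ^ 2 * a) := by
    have hd : ∀ x ∈ uIcc a b, HasDerivAt
        (fun x => (C (s ^ 2 / 3) * X ^ 3 + C (s * t) * X ^ 2 + C (t ^ 2) * X : ℝ[X]).eval x)
        (((C s * X + C t) * (C s * X + C t)).eval x) x := fun x _ => by
      refine (Polynomial.hasDerivAt _ x).congr_deriv ?_
      simp [derivative_pow]
      ring
    rw [intervalIntegral.integral_eq_sub_of_hasDerivAt hd (intervalIntegrable_eval _ _ _)]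
    simp
  rw [h1, h2]
  -- Splitting `f` into its midpoint value and an orthogonal linear part gives `∫ f² = s² (b - a)³ /
  -- 12 + (b - a) f((a + b) / 2)²`; the second term is dropped.
  have : 0 ≤ (b - a) * (s * (a + b) / 2 + t) ^ 2 :=
    mul_nonneg (sub_nonneg.2 hab) (sq_nonneg _)
  linear_combination 12 * this

theorem brokenForm_derivative_le_of_natDegree_le_one {n : ℕ} (hn : n ≠ 0) {f : ℕ → ℝ[X]}
    (hf : ∀ i < n, (f i).natDegree ≤ 1) :
    brokenForm n (fun i => derivative (f i)) (fun i => derivative (f i)) ≤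
      12 * (n : ℝ) ^ 2 * brokenForm n f f := by
  have hn' : (0 : ℝ) < n := by exact_mod_cast Nat.pos_of_ne_zero hn
  rw [brokenForm_apply, brokenForm_apply, Finset.mul_sum]
  refine Finset.sum_le_sum fun i hi => ?_
  have h := integral_derivative_sq_le (a := (i : ℝ) / n) (b := ((i : ℝ) + 1) / n)
    (by gcongr; linarith) (hf i (Finset.mem_range.1 hi))
  have e : ((i : ℝ) + 1) / n - i / n = 1 / n := by ring
  rw [e, div_pow, one_pow, one_div_mul_eq_div, div_le_iff₀ (by positivity)] at h
  linarith

/-- The inverse inequality for the derivatives of a piecewise polynomial of degree at most `p`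
and of class `C^(p-1)` whose odd derivatives of order less than `p` vanish at the boundary. -/
theorem brokenForm_iterate_derivative_succ_le {p n : ℕ} (hn : n ≠ 0) {q : ℕ → ℝ[X]}
    (hdeg : ∀ i < n, (q i).natDegree ≤ p)
    (hmatch : ∀ k < p, Matching n fun i => derivative^[k] (q i))
    (h0 : ∀ k < p, Odd k → (derivative^[k] (q 0)).eval 0 = 0)
    (h1 : ∀ k < p, Odd k → (derivative^[k] (q (n - 1))).eval 1 = 0) {k : ℕ} (hk : k < p) :
    brokenForm n (fun i => derivative^[k + 1] (q i)) (fun i => derivative^[k + 1] (q i)) ≤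
      12 * (n : ℝ) ^ 2 *
        brokenForm n (fun i => derivative^[k] (q i)) (fun i => derivative^[k] (q i)) := by
  -- Induction on `j` descends in the order of the derivative; `j = 0` is `k = p - 1`, where the
  -- pieces of the `k`-th derivative are affine.
  obtain ⟨j, rfl⟩ : ∃ j, p = k + 1 + j := ⟨p - (k + 1), by omega⟩
  induction j generalizing k with
  | zero =>
    simp only [Function.iterate_succ_apply']
    refine brokenForm_derivative_le_of_natDegree_le_one hn fun i hi => ?_
    have := natDegree_iterate_derivative (q i) k
    have := hdeg i hi
    omega
  | succ j ih =>
    have e : k + 1 + (j + 1) = k + 1 + 1 + j := by omega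
    rw [e] at hdeg hmatch h0 h1
    have hind := ih hdeg hmatch h0 h1 (by omega)
    -- Both orders `k` and `k + 1` are below `p`, so both derivatives match at the knots. The odd
    -- one of them removes the boundary terms.
    have hparts := brokenForm_derivative_left hn (hmatch (k + 1) (by omega))
      (hmatch k (by omega))
      (by
        rcases Nat.even_or_odd k with h | h
        · exact .inl (h0 _ (by omega) h.add_one)
        · exact .inr (h0 _ (by omega) h))
      (by
        rcases Nat.even_or_odd k with h | h
        · exact .inl (h1 _ (by omega) h.add_one)
        · exact .inr (h1 _ (by omega) h))
    simp only [← Function.iterate_succ_apply' (f := derivative)] at hparts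
    have hcs := brokenForm_sq_le n (fun i => derivative^[k + 1 + 1] (q i))
      (fun i => derivative^[k] (q i))
    rw [Nat.succ_eq_add_one] at hparts
    rw [hparts, neg_sq] at hcs
    have hA := brokenForm_self_nonneg n fun i => derivative^[k] (q i)
    have hB := brokenForm_self_nonneg n fun i => derivative^[k + 1] (q i)
    -- With `A`, `B`, `C` the squared norms of orders `k`, `k + 1`, `k + 2`, now `B² ≤ C A ≤ 12 n² B
    -- A`; it remains to cancel `B`.
    rcases hB.eq_or_lt with h | h
    · rw [← h]; positivity
    · refine le_of_mul_le_mul_left ?_ h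
      nlinarith [mul_le_mul_of_nonneg_right hind hA]

/-! ### Splines as families of polynomial pieces -/

theorem iteratedDeriv_eval (f : ℝ[X]) (k : ℕ) :
    iteratedDeriv k (fun x => f.eval x) = fun x => (derivative^[k] f).eval x := by
  induction k with
  | zero => simp
  | succ k ih =>
    rw [iteratedDeriv_succ, ih, Function.iterate_succ_apply']
    ext x
    exact Polynomial.deriv _

/-- `q i` is the restriction of `u` to the `i`-th subinterval of the grid. -/
def HasPieces (n : ℕ) (u : ℝ → ℝ) (q : ℕ → ℝ[X]) : Prop :=
  ∀ i < n, EqOn u (fun x => (q i).eval x) (Ioo ((i : ℝ) / n) (((i : ℝ) + 1) / n))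

theorem IsSpline.exists_hasPieces {p n : ℕ} {u : ℝ → ℝ} (hu : IsSpline p n u) :
    ∃ q : ℕ → ℝ[X], (∀ i < n, (q i).natDegree ≤ p) ∧ HasPieces n u q := by
  choose q hq hqu using hu.piecewise
  refine ⟨fun i => if h : i < n then q ⟨i, h⟩ else 0, fun i hi => ?_, fun i hi => ?_⟩
  · simpa [hi] using hq ⟨i, hi⟩
  · simpa [hi] using hqu ⟨i, hi⟩

theorem HasPieces.iteratedDeriv {n : ℕ} {u : ℝ → ℝ} {q : ℕ → ℝ[X]} (hq : HasPieces n u q)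
    (k : ℕ) : HasPieces n (iteratedDeriv k u) fun i => derivative^[k] (q i) := by
  intro i hi x hx
  have h : u =ᶠ[𝓝 x] fun x => (q i).eval x := by
    filter_upwards [isOpen_Ioo.mem_nhds hx] with y hy using hq i hi hy
  rw [h.iteratedDeriv_eq, iteratedDeriv_eval]

theorem HasPieces.deriv {n : ℕ} {u : ℝ → ℝ} {q : ℕ → ℝ[X]} (hq : HasPieces n u q) :
    HasPieces n (deriv u) fun i => derivative (q i) := by
  simpa using hq.iteratedDeriv 1

theorem HasPieces.tendsto_left {n : ℕ} {u : ℝ → ℝ} {q : ℕ → ℝ[X]} (hq : HasPieces n u q)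
    {i : ℕ} (hi : i < n) :
    Tendsto u (𝓝[>] ((i : ℝ) / n)) (𝓝 ((q i).eval ((i : ℝ) / n))) := by
  have hn : (0 : ℝ) < n := by exact_mod_cast (Nat.zero_le _).trans_lt hi
  refine Tendsto.congr' ?_ ((q i).continuous.tendsto _ |>.mono_left nhdsWithin_le_nhds)
  have hlt : (i : ℝ) / n < ((i : ℝ) + 1) / n := by gcongr; linarith
  filter_upwards [Ioo_mem_nhdsGT hlt] with x hx using (hq i hi hx).symm

theorem HasPieces.tendsto_right {n : ℕ} {u : ℝ → ℝ} {q : ℕ → ℝ[X]} (hq : HasPieces n u q)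
    {i : ℕ} (hi : i < n) :
    Tendsto u (𝓝[<] (((i : ℝ) + 1) / n)) (𝓝 ((q i).eval (((i : ℝ) + 1) / n))) := by
  have hn : (0 : ℝ) < n := by exact_mod_cast (Nat.zero_le _).trans_lt hi
  refine Tendsto.congr' ?_ ((q i).continuous.tendsto _ |>.mono_left nhdsWithin_le_nhds)
  have hlt : (i : ℝ) / n < ((i : ℝ) + 1) / n := by gcongr; linarith
  filter_upwards [Ioo_mem_nhdsLT hlt] with x hx using (hq i hi hx).symm

/-- At an interior knot the two adjacent polynomials take the one-sided limits of `u` as values, and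
continuity identifies both with the value of `u`. -/
theorem HasPieces.matching {n : ℕ} {u : ℝ → ℝ} {q : ℕ → ℝ[X]} (hq : HasPieces n u q)
    (hu : ContinuousOn u (Ioo 0 1)) : Matching n q := by
  intro i hi
  have hn : (0 : ℝ) < n := by exact_mod_cast (Nat.zero_le _).trans_lt hi
  have hx : ((i : ℝ) + 1) / n ∈ Ioo (0 : ℝ) 1 :=
    ⟨by positivity, by rw [div_lt_one hn]; exact_mod_cast hi⟩
  have hc : Tendsto u (𝓝 (((i : ℝ) + 1) / n)) (𝓝 (u (((i : ℝ) + 1) / n))) :=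
    hu.continuousAt (isOpen_Ioo.mem_nhds hx)
  have h1 := hq.tendsto_left hi
  push_cast at h1
  rw [tendsto_nhds_unique (hq.tendsto_right (Nat.lt_of_succ_lt hi))
      (hc.mono_left nhdsWithin_le_nhds),
    tendsto_nhds_unique h1 (hc.mono_left nhdsWithin_le_nhds)]

theorem HasPieces.eval_zero {n : ℕ} [NeZero n] {u : ℝ → ℝ} {q : ℕ → ℝ[X]}
    (hq : HasPieces n u q) {a : ℝ} (hu : Tendsto u (𝓝[>] 0) (𝓝 a)) : (q 0).eval 0 = a := by
  have h := hq.tendsto_left (Nat.pos_of_ne_zero (NeZero.ne n))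
  rw [Nat.cast_zero, zero_div] at h
  exact tendsto_nhds_unique h hu

theorem HasPieces.eval_one {n : ℕ} [NeZero n] {u : ℝ → ℝ} {q : ℕ → ℝ[X]}
    (hq : HasPieces n u q) {a : ℝ} (hu : Tendsto u (𝓝[<] 1) (𝓝 a)) :
    (q (n - 1)).eval 1 = a := by
  have hn : 1 ≤ n := Nat.pos_of_ne_zero (NeZero.ne n)
  have h := hq.tendsto_right (i := n - 1) (by omega)
  have hn' : (n : ℝ) ≠ 0 := by exact_mod_cast NeZero.ne n
  rw [Nat.cast_sub hn, Nat.cast_one, sub_add_cancel, div_self hn'] at h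
  exact tendsto_nhds_unique h hu

/-- Values at the knots do not affect the integral, so this applies also to `deriv u`, which may
jump there. -/
theorem HasPieces.integral_mul {n : ℕ} [NeZero n] {u v : ℝ → ℝ} {q r : ℕ → ℝ[X]}
    (hq : HasPieces n u q) (hr : HasPieces n v r) :
    ∫ x in Ioo (0 : ℝ) 1, u x * v x = brokenForm n q r := by
  have hn : (n : ℝ) ≠ 0 := by exact_mod_cast NeZero.ne n
  have hle : ∀ i : ℕ, (i : ℝ) / n ≤ ((i : ℝ) + 1) / n := fun i => by gcongr; linarith
  have heq : ∀ i < n, EqOn (fun x => (q i * r i).eval x) (fun x => u x * v x)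
      (Ioo ((i : ℝ) / n) (((i : ℝ) + 1) / n)) := fun i hi x hx => by
    simp [hq i hi hx, hr i hi hx]
  have hsum := intervalIntegral.sum_integral_adjacent_intervals (μ := volume)
    (f := fun x => u x * v x) (a := fun i : ℕ => (i : ℝ) / n) (n := n) fun i hi => by
      have h := (intervalIntegrable_eval (q i * r i) ((i : ℝ) / n) (((i : ℝ) + 1) / n)).congr_uIoo
        (g := fun x => u x * v x) (by rw [uIoo_of_le (hle i)]; exact heq i hi)
      simpa using h
  simp only [Nat.cast_zero, zero_div, div_self hn, Nat.cast_add, Nat.cast_one] at hsum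
  rw [← integral_Ioc_eq_integral_Ioo, ← intervalIntegral.integral_of_le zero_le_one, ← hsum,
    brokenForm_apply]
  refine Finset.sum_congr rfl fun i hi => ?_
  exact (intervalIntegral.integral_congr_Ioo_of_le (hle i) (heq i (Finset.mem_range.1 hi))).symm

theorem IsSpline.matching {p n : ℕ} {u : ℝ → ℝ} (hu : IsSpline p n u) {q : ℕ → ℝ[X]}
    (hq : HasPieces n u q) {k : ℕ} (hk : k < p) : Matching n fun i => derivative^[k] (q i) := by
  refine (hq.iteratedDeriv k).matching ?_
  have h := hu.contDiffOn.continuousOn_iteratedDerivWithin (m := k)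
    (by exact_mod_cast Nat.le_sub_one_of_lt hk) isOpen_Ioo.uniqueDiffOn
  exact h.congr fun x hx => (iteratedDerivWithin_of_isOpen isOpen_Ioo hx).symm

/-! ### Energy estimate for the projector -/

variable {p n : ℕ} [NeZero n]

theorem massForm_eq {u v : splineSpace p n} {q r : ℕ → ℝ[X]}
    (hq : HasPieces n (u : ℝ → ℝ) q) (hr : HasPieces n (v : ℝ → ℝ) r) :
    massForm p n u v = brokenForm n q r :=
  hq.integral_mul hr

theorem gradForm_eq {u v : splineSpace p n} {q r : ℕ → ℝ[X]}
    (hq : HasPieces n (u : ℝ → ℝ) q) (hr : HasPieces n (v : ℝ → ℝ) r) :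
    gradForm p n u v = brokenForm n (fun i => derivative (q i)) (fun i => derivative (r i)) :=
  hq.deriv.integral_mul hr.deriv

theorem energyForm_apply (u v : splineSpace p n) :
    energyForm p n u v = gradForm p n u v + massForm p n u v := rfl

/-- A consequence of the inverse inequality in `splineSpaceTilde` for an arbitrary spline `u` as
test function: the derivative is moved from `u` to `v` by parts if `p` is at least `2`, while
for `p = 1` all splines belong to `splineSpaceTilde` and `u = v` is enough. -/
theorem gradForm_sq_le (hp : 1 ≤ p) {v : splineSpace p n} (hv : v ∈ splineSpaceTilde p n)
    (u : splineSpace p n) (huv : p = 1 → u = v) :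
    gradForm p n v u ^ 2 ≤ 12 * (n : ℝ) ^ 2 * gradForm p n v v * massForm p n u u := by
  have hn : n ≠ 0 := NeZero.ne n
  obtain ⟨q, hdeg, hq⟩ := v.2.exists_hasPieces
  obtain ⟨r, -, hr⟩ := u.2.exists_hasPieces
  have h0 : ∀ k < p, Odd k → (derivative^[k] (q 0)).eval 0 = 0 := by
    rintro k hk ⟨l, rfl⟩
    exact (hq.iteratedDeriv _).eval_zero (hv l hk).1
  have h1 : ∀ k < p, Odd k → (derivative^[k] (q (n - 1))).eval 1 = 0 := by
    rintro k hk ⟨l, rfl⟩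
    exact (hq.iteratedDeriv _).eval_one (hv l hk).2
  have hinv := fun k hk => brokenForm_iterate_derivative_succ_le hn hdeg
    (fun k hk => v.2.matching hq hk) h0 h1 (k := k) hk
  rcases hp.eq_or_lt with rfl | hp
  · obtain rfl := huv rfl
    have h := hinv 0 one_pos
    simp only [zero_add, Function.iterate_one, Function.iterate_zero, id] at h
    rw [gradForm_eq hq hq, massForm_eq hq hq, sq]
    have := mul_le_mul_of_nonneg_right h (brokenForm_self_nonneg n fun i => derivative (q i))
    linarith
  · have h := hinv 1 hp
    -- Both boundary terms are removed by `v' = 0`; from `u` only continuity is needed.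
    have hparts := brokenForm_derivative_left hn (v.2.matching hq hp)
      (u.2.matching hr (zero_lt_one.trans hp)) (.inl (h0 1 hp odd_one)) (.inl (h1 1 hp odd_one))
    have hcs := brokenForm_sq_le n (fun i => derivative (derivative (q i))) r
    simp only [Function.iterate_succ, Function.iterate_zero, Function.comp, id] at h hparts
    rw [hparts, neg_sq] at hcs
    rw [gradForm_eq hq hr, gradForm_eq hq hq, massForm_eq hr hr]
    exact hcs.trans (mul_le_mul_of_nonneg_right h (brokenForm_self_nonneg n r))

theorem gradForm_self_nonneg (u : splineSpace p n) : 0 ≤ gradForm p n u u :=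
  integral_nonneg fun _ => mul_self_nonneg _

theorem massForm_self_nonneg (u : splineSpace p n) : 0 ≤ massForm p n u u :=
  integral_nonneg fun _ => mul_self_nonneg _

theorem energyForm_self_nonneg (u : splineSpace p n) : 0 ≤ energyForm p n u u :=
  add_nonneg (gradForm_self_nonneg u) (massForm_self_nonneg u)

theorem massForm_sq_le (u v : splineSpace p n) :
    massForm p n u v ^ 2 ≤ massForm p n u u * massForm p n v v := by
  obtain ⟨q, -, hq⟩ := u.2.exists_hasPieces
  obtain ⟨r, -, hr⟩ := v.2.exists_hasPieces
  rw [massForm_eq hq hr, massForm_eq hq hq, massForm_eq hr hr]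
  exact brokenForm_sq_le n q r

theorem projTilde_mem (u : splineSpace p n) : projTilde p n u ∈ splineSpaceTilde p n :=
  Submodule.projection_apply_mem _ u

theorem energyForm_projTilde_sub (u : splineSpace p n) :
    energyForm p n (projTilde p n u) (u - projTilde p n u) = 0 :=
  LinearMap.BilinForm.mem_orthogonal_iff.1
    (Submodule.sub_projection_mem (isCompl_orthogonal p n) u) _ (projTilde_mem u)

/-- No odd order lies below `1`, so for `p = 1` the boundary conditions are void. -/
theorem projTilde_degree_one (u : splineSpace 1 n) : projTilde 1 n u = u :=
  Submodule.projection_apply_of_mem_left _ fun l hl => absurd hl (by omega)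

/-- This is the core estimate: the energy of the projection is controlled by the L² norm of `u`
alone, at the price of `n²`. -/
theorem energyForm_projTilde_le (hp : 1 ≤ p) (u : splineSpace p n) :
    energyForm p n (projTilde p n u) (projTilde p n u) ≤
      24 * (n : ℝ) ^ 2 * massForm p n u u := by
  set v := projTilde p n u with hv
  have horth : energyForm p n v v = energyForm p n v u := by
    have h := energyForm_projTilde_sub u
    rw [map_sub, sub_eq_zero] at h
    exact h.symm
  have h1 := gradForm_sq_le hp (projTilde_mem u) u (by
    rintro rfl
    exact (projTilde_degree_one u).symm)
  rw [← hv] at h1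
  have h2 := massForm_sq_le v u
  have hn : (1 : ℝ) ≤ (n : ℝ) ^ 2 :=
    one_le_pow₀ (by exact_mod_cast Nat.pos_of_ne_zero (NeZero.ne n))
  have hG := gradForm_self_nonneg v
  have hM := massForm_self_nonneg v
  have hU := massForm_self_nonneg u
  -- Cauchy-Schwarz is weakened by `1 ≤ 12 n²` to have the same factor as the gradient bound `h1`.
  have h2' : massForm p n v u ^ 2 ≤ 12 * (n : ℝ) ^ 2 * massForm p n v v * massForm p n u u := by
    nlinarith [mul_nonneg hM hU]
  have key : energyForm p n v v ^ 2 ≤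
      24 * (n : ℝ) ^ 2 * massForm p n u u * energyForm p n v v := by
    rw [sq]
    -- Only the two factors on the left become `(v, u)_A`. Then `(a + b)² ≤ 2 a² + 2 b²` doubles the
    -- factor `12` to `24`.
    nth_rewrite 1 2 [horth]
    rw [energyForm_apply v u, energyForm_apply v v]
    nlinarith [sq_nonneg (gradForm p n v u - massForm p n v u)]
  rcases (energyForm_self_nonneg v).eq_or_lt with h | h
  · rw [← h]; positivity
  · exact le_of_mul_le_mul_right (by rwa [← sq]) h

/-- Pythagoras for the `A`-orthogonal splitting of `u`, with the projected part estimated. -/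
theorem energyForm_le (hp : 1 ≤ p) (u : splineSpace p n) :
    energyForm p n u u ≤ 24 * (n : ℝ) ^ 2 * massForm p n u u +
      energyForm p n (u - projTilde p n u) (u - projTilde p n u) := by
  have h := energyForm_projTilde_sub u
  have h' := energyForm_isRefl p n _ _ h
  have e : energyForm p n u u = energyForm p n (projTilde p n u) (projTilde p n u) +
      energyForm p n (u - projTilde p n u) (u - projTilde p n u) := by
    simp only [map_sub, LinearMap.sub_apply] at h h' ⊢
    linarith
  linarith [energyForm_projTilde_le hp u]

/-! ### From matrices to bilinear forms, and the final bound -/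

/-- The right-hand side does not involve the basis, which makes the final constant independent of
its choice. -/
theorem smootherMatrix_mulVec_dotProduct {m : ℕ}
    (b : Module.Basis (Fin m) ℝ (splineSpace p n)) (u : splineSpace p n) :
    (smootherMatrix p n b).mulVec (b.repr u) ⬝ᵥ b.repr u = (n : ℝ) ^ 2 * massForm p n u u +
      energyForm p n (u - projTilde p n u) (u - projTilde p n u) := by
  have hM : massMatrix p n b = LinearMap.BilinForm.toMatrix b (massForm p n) := by
    ext i j
    simp [massMatrix]
  have hA : stiffnessMatrix p n b = LinearMap.BilinForm.toMatrix b (energyForm p n) := by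
    ext i j
    simp [stiffnessMatrix]
  have hT : (1 - projMatrix p n b).mulVec (b.repr u) = b.repr (u - projTilde p n u) := by
    rw [Matrix.sub_mulVec, Matrix.one_mulVec, projMatrix, LinearMap.toMatrix_mulVec_repr]
    simp
  rw [smootherMatrix, dotProduct_comm, Matrix.add_mulVec, dotProduct_add, Matrix.smul_mulVec,
    dotProduct_smul, hM, ← LinearMap.BilinForm.apply_eq_dotProduct_toMatrix_mulVec,
    ← Matrix.mulVec_mulVec, ← Matrix.mulVec_mulVec, Matrix.dotProduct_mulVec,
    Matrix.vecMul_transpose, hT, hA,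
    ← LinearMap.BilinForm.apply_eq_dotProduct_toMatrix_mulVec]
  simp

end IgA

end

theorem lemma4p3 :
    ∃ c : ℝ, 0 < c ∧
      ∀ (p n₀ ℓ : ℕ) [NeZero n₀], 1 ≤ p → p < n₀ →
        ∀ (m : ℕ) (b : Module.Basis (Fin m) ℝ (IgA.splineSpace p (n₀ * 2 ^ ℓ)))
          (u : IgA.splineSpace p (n₀ * 2 ^ ℓ)),
          IgA.energyNorm p (n₀ * 2 ^ ℓ) u ≤
            c * IgA.matrixNorm (IgA.smootherMatrix p (n₀ * 2 ^ ℓ) b) (b.repr u) := by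
  -- After squaring, `5² = 25` dominates both the factor `24` of the mass term and the factor `1` of
  -- the projection error.
  refine ⟨5, by norm_num, fun p n₀ ℓ _ hp _ m b u => ?_⟩
  have hle := IgA.energyForm_le hp u
  have hM := mul_nonneg (sq_nonneg ((n₀ * 2 ^ ℓ : ℕ) : ℝ)) (IgA.massForm_self_nonneg u)
  have hW := IgA.energyForm_self_nonneg (u - IgA.projTilde p (n₀ * 2 ^ ℓ) u)
  rw [IgA.energyNorm, IgA.matrixNorm, IgA.smootherMatrix_mulVec_dotProduct]
  refine Real.sqrt_le_iff.2 ⟨by positivity, ?_⟩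
  rw [mul_pow, Real.sq_sqrt (add_nonneg hM hW)]
  linarith
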